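/- Let $\mathscr H$ and $\mathscr K$ be complex Hilbert spaces, let $\mathbb B(\mathscr H)$ and $\mathbb B(\mathscr K)$ be the algebras of bounded linear operators on them with the usual (Loewner) order of self-adjoint operators, and let $I$ denote the identity operator on either space. Let $1<r\le 2$, let $a_1,\dots,a_n>0$ be real numbers, and let $\phi_1,\dots,\phi_n:\mathbb B(\mathscr H)\to\mathbb B(\mathscr K)$ be positive linear maps (that is, linear maps with $\phi_i(X)\ge 0$ whenever $X\ge 0$) satisfying $$\sum_{i=1}^n a_i^{\frac1{1-r}}\,\phi_i(I)\;\le\;\Bigl(\sum_{i=1}^n a_i^{\frac1{1-r}}\Bigr) I .$$ Then $$\Bigl(\sum_{i=1}^n \phi_i(A_i)\Bigr)^{r}\;\le\;\Bigl(\sum_{i=1}^n a_i^{\frac1{1-r}}\Bigr)^{r-1}\sum_{i=1}^n a_i\,\phi_i(A_i^{r})$$ for all positive operators $A_1,\dots,A_n\in\mathbb B(\mathscr H)$ (positive meaning positive semidefinite, $A_i\ge 0$), where the $r$-th power of a positive operator is defined by the continuous functional calculus. -/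

import Mathlib

open Set Filter MeasureTheory
open scoped NNReal Topology

/-! ### Kadison's inequality via Bernstein polynomials -/

section Kadison

variable {A B : Type*} [CStarAlgebra A] [PartialOrder A] [StarOrderedRing A]
  [CStarAlgebra B] [PartialOrder B] [StarOrderedRing B]

/-! Everything reduces to Jensen's inequality `ψ x ^ r ≤ ψ (x ^ r)` for one positive map with `ψ 1 ≤
1`. Put `c i = a i ^ (1 / (1 - r))` and `C = ∑ i, c i`. Since `c i ^ (1 - r) = a i`, Jensen with
weights `c i / C` at the points `x i / c i`, multiplied by `C ^ r`, is the claim. A family of maps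
is a single map on the product algebra.

For `r = 2` Jensen is Kadison's inequality (`PositiveLinearMap.mul_self_le`). For `1 < r < 2`, `x ^
r` is an integral of positive multiples of `y ^ 2 / (t + y)`, and conjugating by square roots
reduces each of these to Kadison (`PositiveLinearMap.cfc_sq_div_add_le`). Plain positivity suffices.
-/

/-- Operator Jensen inequality for the square and finitely many positive weights. -/
lemma sum_smul_mul_self_le {ι : Type*} (s : Finset ι) (w : ι → ℝ) (P : ι → B)
    (hP : ∀ i ∈ s, 0 ≤ P i) (hsum : ∑ i ∈ s, P i ≤ 1) :
    (∑ i ∈ s, w i • P i) * (∑ i ∈ s, w i • P i) ≤ ∑ i ∈ s, (w i * w i) • P i := by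
  set S := ∑ i ∈ s, w i • P i with hS
  have hSa : IsSelfAdjoint S := by
    refine isSelfAdjoint_sum s fun i hi => ?_
    exact (IsSelfAdjoint.all (w i)).smul (hP i hi).isSelfAdjoint
  -- An operator variance about the mean `S`; the cubic term in its expansion is at most `S * S`
  -- because the weights sum to at most 1.
  have hpos : 0 ≤ ∑ i ∈ s, (w i • 1 - S) * P i * (w i • 1 - S) := by
    refine Finset.sum_nonneg fun i hi => ?_
    refine IsSelfAdjoint.conjugate_nonneg (hP i hi) (IsSelfAdjoint.sub ?_ hSa)
    exact (IsSelfAdjoint.all (w i)).smul (.one B)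
  have hexp : ∑ i ∈ s, (w i • 1 - S) * P i * (w i • 1 - S)
      = ∑ i ∈ s, (w i * w i) • P i - S * S - S * S + S * (∑ i ∈ s, P i) * S := by
    have : ∀ i ∈ s, (w i • 1 - S) * P i * (w i • 1 - S)
        = (w i * w i) • P i - (w i • P i) * S - S * (w i • P i) + S * P i * S := by
      intro i _
      simp only [sub_mul, mul_sub, smul_mul_assoc, mul_smul_comm, one_mul, mul_one, mul_smul,
        mul_assoc, smul_sub]
      abel
    rw [Finset.sum_congr rfl this, Finset.sum_add_distrib, Finset.sum_sub_distrib,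
      Finset.sum_sub_distrib, ← Finset.sum_mul, ← Finset.mul_sum, ← hS, ← Finset.sum_mul,
      ← Finset.mul_sum]
  have hle : S * (∑ i ∈ s, P i) * S ≤ S * S := by
    simpa using hSa.conjugate_le_conjugate hsum
  rw [hexp] at hpos
  have h2 : 0 ≤ ∑ i ∈ s, (w i * w i) • P i - S * S - S * S + S * S :=
    hpos.trans (by gcongr)
  rw [sub_add_cancel] at h2
  exact sub_nonneg.mp h2

lemma aeval_bernsteinPolynomial_nonneg {x : A} (hx₀ : 0 ≤ x) (hx₁ : x ≤ 1) (n k : ℕ) :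
    0 ≤ Polynomial.aeval x (bernsteinPolynomial ℝ n k) := by
  rw [← cfc_polynomial (R := ℝ) _ x hx₀.isSelfAdjoint]
  refine cfc_nonneg fun y hy => ?_
  have h₀ : 0 ≤ y := spectrum_nonneg_of_nonneg hx₀ hy
  have h₁ : y ≤ 1 := (CFC.le_one_iff (R := ℝ) x hx₀.isSelfAdjoint).mp hx₁ y hy
  have h₂ : 0 ≤ 1 - y := by linarith
  simp only [bernsteinPolynomial, Polynomial.eval_mul, Polynomial.eval_pow, Polynomial.eval_sub,
    Polynomial.eval_natCast, Polynomial.eval_X, Polynomial.eval_one]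
  positivity

/-- The Bernstein polynomials at `x` form a positive partition of unity, with nodes `k / n` of mean
`x` and second moment `x² + (x - x²) / n`. Their images under `ψ` are admissible weights for the
finite Jensen inequality. -/
lemma PositiveLinearMap.mul_self_le_add_inv_smul (ψ : A →ₚ[ℂ] B) (hψ : ψ 1 ≤ 1) {x : A}
    (hx₀ : 0 ≤ x) (hx₁ : x ≤ 1) {n : ℕ} (hn : n ≠ 0) :
    ψ x * ψ x ≤ ψ (x * x) + (n : ℝ)⁻¹ • ψ (x - x * x) := by
  have hn' : (n : ℝ) ≠ 0 := by exact_mod_cast hn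
  set p : ℕ → A := fun k => Polynomial.aeval x (bernsteinPolynomial ℝ n k) with hp
  have hp₀ : ∑ k ∈ Finset.range (n + 1), p k = 1 := by
    simp only [hp, ← map_sum, bernsteinPolynomial.sum, map_one]
  have hp₁ : ∑ k ∈ Finset.range (n + 1), (k : ℝ) • p k = (n : ℝ) • x := by
    have := congrArg (Polynomial.aeval x) (bernsteinPolynomial.sum_smul ℝ n)
    simpa [map_sum, hp, Nat.cast_smul_eq_nsmul] using this
  have hp₂ : ∑ k ∈ Finset.range (n + 1), ((k : ℝ) * k) • p k
      = ((n : ℝ) * (n - 1)) • (x * x) + (n : ℝ) • x := by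
    have h := congrArg (Polynomial.aeval x) (bernsteinPolynomial.sum_mul_smul ℝ n)
    have h' : ∑ k ∈ Finset.range (n + 1), ((k : ℝ) * k - k) • p k
        = ((n : ℝ) * n - n) • (x * x) := by
      -- The Bernstein identity is a factorial moment; truncation of `k - 1` at `k = 0` is harmless,
      -- being multiplied by 0.
      have hc : ∀ k : ℕ, (k : ℝ) * k - k = ((k * (k - 1) : ℕ) : ℝ) := by
        rintro (_ | k)
        · simp
        · push_cast [Nat.add_sub_cancel]; ring
      simp only [hc, Nat.cast_smul_eq_nsmul, hp]
      rw [map_sum] at h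
      simpa only [map_nsmul, map_mul, Polynomial.aeval_X, pow_two] using h
    rw [mul_sub, mul_one, ← h', ← hp₁, ← Finset.sum_add_distrib]
    exact Finset.sum_congr rfl fun k _ => by rw [← add_smul, sub_add_cancel]
  have key := sum_smul_mul_self_le (Finset.range (n + 1)) (fun k => (k : ℝ) / n)
    (fun k => ψ (p k))
    (fun k _ => map_nonneg ψ (aeval_bernsteinPolynomial_nonneg hx₀ hx₁ n k))
    (by rw [← map_sum, hp₀]; exact hψ)
  have e₁ : ∑ k ∈ Finset.range (n + 1), ((k : ℝ) / n) • ψ (p k) = ψ x := by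
    simp only [← PositiveLinearMap.map_smul_of_tower, ← map_sum, div_eq_inv_mul, mul_smul,
      ← Finset.smul_sum, hp₁]
    rw [inv_smul_smul₀ hn']
  have e₂ : ∑ k ∈ Finset.range (n + 1), ((k : ℝ) / n * (k / n)) • ψ (p k)
      = ψ (x * x) + (n : ℝ)⁻¹ • ψ (x - x * x) := by
    have hc : ∀ k : ℕ, (k : ℝ) / n * (k / n) = ((n : ℝ)⁻¹ * (n : ℝ)⁻¹) * (k * k) := by
      intro k; ring
    simp only [← PositiveLinearMap.map_smul_of_tower, ← map_sum, ← map_add, hc, mul_smul _ (_ * _),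
      ← Finset.smul_sum, hp₂]
    congr 1
    rw [smul_add, smul_smul, smul_smul, smul_sub]
    have h1 : (n : ℝ)⁻¹ * (n : ℝ)⁻¹ * (n * (n - 1)) = 1 - (n : ℝ)⁻¹ := by field_simp
    have h2 : (n : ℝ)⁻¹ * (n : ℝ)⁻¹ * n = (n : ℝ)⁻¹ := by field_simp
    rw [h1, h2, sub_smul, one_smul]
    abel
  simp only [e₁, e₂] at key
  exact key

/-- **Kadison's inequality** for subunital positive maps and positive contractions. -/
theorem PositiveLinearMap.mul_self_le_of_le_one (ψ : A →ₚ[ℂ] B) (hψ : ψ 1 ≤ 1) {x : A}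
    (hx₀ : 0 ≤ x) (hx₁ : x ≤ 1) : ψ x * ψ x ≤ ψ (x * x) := by
  have hlim : Tendsto (fun n : ℕ => ψ (x * x) + (n : ℝ)⁻¹ • ψ (x - x * x)) atTop
      (𝓝 (ψ (x * x))) := by
    simpa using tendsto_const_nhds.add
      ((tendsto_inv_atTop_nhds_zero_nat (𝕜 := ℝ)).smul_const (ψ (x - x * x)))
  refine ge_of_tendsto hlim ?_
  filter_upwards [eventually_ne_atTop 0] with n hn
  exact ψ.mul_self_le_add_inv_smul hψ hx₀ hx₁ hn

/-- **Kadison's inequality** for subunital positive maps and positive elements. -/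
theorem PositiveLinearMap.mul_self_le (ψ : A →ₚ[ℂ] B) (hψ : ψ 1 ≤ 1) {x : A} (hx : 0 ≤ x) :
    ψ x * ψ x ≤ ψ (x * x) := by
  -- Scaling to a contraction; the `+ 1` keeps `c` invertible when `x = 0`.
  set c : ℝ := ‖x‖ + 1 with hc
  have hc₀ : 0 < c := by positivity
  have hle : c⁻¹ • x ≤ 1 := by
    have : x ≤ c • (1 : A) := by
      rw [← Algebra.algebraMap_eq_smul_one]
      refine hx.isSelfAdjoint.le_algebraMap_norm_self.trans ?_
      exact algebraMap_mono A (by linarith)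
    calc c⁻¹ • x ≤ c⁻¹ • (c • (1 : A)) := by gcongr
      _ = 1 := inv_smul_smul₀ hc₀.ne' _
  have h := ψ.mul_self_le_of_le_one hψ (smul_nonneg (by positivity) hx) hle
  have h' := smul_le_smul_of_nonneg_left h (mul_nonneg hc₀.le hc₀.le)
  simp only [PositiveLinearMap.map_smul_of_tower, smul_mul_smul_comm, smul_smul] at h'
  have e : c * c * (c⁻¹ * c⁻¹) = 1 := by field_simp
  simpa [e] using h'

end Kadison

/-! ### Jensen's inequality for powers -/

section Jensen

variable {A B : Type*} [CStarAlgebra A] [PartialOrder A] [StarOrderedRing A]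
  [CStarAlgebra B] [PartialOrder B] [StarOrderedRing B]

/-- The positive map `y ↦ q * ψ (s * y * s) * q`. -/
noncomputable def PositiveLinearMap.conj (ψ : A →ₚ[ℂ] B) {s : A} {q : B} (hs : IsSelfAdjoint s)
    (hq : IsSelfAdjoint q) : A →ₚ[ℂ] B :=
  .mk₀ ((LinearMap.mulLeftRight ℂ (q, q)) ∘ₗ ψ.toLinearMap ∘ₗ (LinearMap.mulLeftRight ℂ (s, s)))
    fun _ hy => hq.conjugate_nonneg (map_nonneg ψ (hs.conjugate_nonneg hy))

lemma PositiveLinearMap.conj_apply (ψ : A →ₚ[ℂ] B) {s : A} {q : B} (hs : IsSelfAdjoint s)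
    (hq : IsSelfAdjoint q) (y : A) : ψ.conj hs hq y = q * ψ (s * y * s) * q := rfl

/-- Jensen's inequality for the operator convex function `y ↦ y ^ 2 / (t + y)`. -/
lemma PositiveLinearMap.cfc_sq_div_add_le (ψ : A →ₚ[ℂ] B) (hψ : ψ 1 ≤ 1) {x : A} (hx : 0 ≤ x)
    {t : ℝ} (ht : 0 < t) :
    cfc (fun y : ℝ => y ^ 2 / (t + y)) (ψ x) ≤ ψ (cfc (fun y : ℝ => y ^ 2 / (t + y)) x) := by
  have hP : 0 ≤ ψ x := map_nonneg ψ hx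
  have hxs : ∀ y ∈ spectrum ℝ x, 0 < t + y := fun y hy =>
    add_pos_of_pos_of_nonneg ht (spectrum_nonneg_of_nonneg hx hy)
  have hPs : ∀ y ∈ spectrum ℝ (ψ x), 0 < t + y := fun y hy =>
    add_pos_of_pos_of_nonneg ht (spectrum_nonneg_of_nonneg hP hy)
  have hxa := hx.isSelfAdjoint
  have hPa := hP.isSelfAdjoint
  -- With `s = (t + x)^(1/2)`, `q = (t + ψ x)^(-1/2)` and `z = x / (t + x)`, Kadison is applied at
  -- `z` to `y ↦ q * ψ (s * y * s) * q`. Here `s * z * s = x` and `s * z² * s = x² / (t + x)`; `u`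
  -- is the inverse of `q`.
  set s : A := cfc (fun y : ℝ => √(t + y)) x with hs
  set z : A := cfc (fun y : ℝ => y / (t + y)) x with hz
  set q : B := cfc (fun y : ℝ => (√(t + y))⁻¹) (ψ x) with hq
  set u : B := cfc (fun y : ℝ => √(t + y)) (ψ x) with hu
  have cs : ContinuousOn (fun y : ℝ => √(t + y)) (spectrum ℝ x) := by fun_prop
  have cz : ContinuousOn (fun y : ℝ => y / (t + y)) (spectrum ℝ x) :=
    ContinuousOn.div (by fun_prop) (by fun_prop) fun y hy => (hxs y hy).ne'
  have cu : ContinuousOn (fun y : ℝ => √(t + y)) (spectrum ℝ (ψ x)) := by fun_prop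
  have cq : ContinuousOn (fun y : ℝ => (√(t + y))⁻¹) (spectrum ℝ (ψ x)) :=
    ContinuousOn.inv₀ cu fun y hy => (Real.sqrt_pos.mpr (hPs y hy)).ne'
  have hsa : IsSelfAdjoint s := cfc_predicate _ _
  have hqa : IsSelfAdjoint q := cfc_predicate _ _
  have hua : IsSelfAdjoint u := cfc_predicate _ _
  have hz₀ : 0 ≤ z := cfc_nonneg fun y hy =>
    div_nonneg (spectrum_nonneg_of_nonneg hx hy) (hxs y hy).le
  have hz₁ : z ≤ 1 := cfc_le_one _ _ fun y hy => by
    rw [div_le_one (hxs y hy)]; linarith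
  have huq : u * q = 1 := by
    rw [hu, hq, ← cfc_mul _ _ _ cu cq, ← cfc_const_one ℝ (ψ x)]
    exact cfc_congr fun y hy => mul_inv_cancel₀ (Real.sqrt_pos.mpr (hPs y hy)).ne'
  have hqu : q * u = 1 := by
    rw [hu, hq, ← cfc_mul _ _ _ cq cu, ← cfc_const_one ℝ (ψ x)]
    exact cfc_congr fun y hy => inv_mul_cancel₀ (Real.sqrt_pos.mpr (hPs y hy)).ne'
  have hss : s * 1 * s = t • 1 + x := by
    rw [mul_one, hs, ← cfc_mul _ _ _ cs cs, ← Algebra.algebraMap_eq_smul_one]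
    conv_rhs => rw [← cfc_id' ℝ x, ← cfc_const_add t _ x]
    exact cfc_congr fun y hy => Real.mul_self_sqrt (hxs y hy).le
  have huu : u * u = t • 1 + ψ x := by
    rw [hu, ← cfc_mul _ _ _ cu cu, ← Algebra.algebraMap_eq_smul_one]
    conv_rhs => rw [← cfc_id' ℝ (ψ x), ← cfc_const_add t _ (ψ x)]
    exact cfc_congr fun y hy => Real.mul_self_sqrt (hPs y hy).le
  have hszs : s * z * s = x := by
    rw [hs, hz, ← cfc_mul _ _ _ cs cz, ← cfc_mul _ _ _ (cs.fun_mul cz) cs]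
    conv_rhs => rw [← cfc_id' ℝ x]
    refine cfc_congr fun y hy => ?_
    have h := hxs y hy
    have := Real.mul_self_sqrt h.le
    calc √(t + y) * (y / (t + y)) * √(t + y) = (√(t + y) * √(t + y)) * y / (t + y) := by ring
      _ = y := by rw [this]; field_simp
  have hszzs : s * (z * z) * s = cfc (fun y : ℝ => y ^ 2 / (t + y)) x := by
    rw [hs, hz, ← cfc_mul _ _ _ cz cz, ← cfc_mul _ _ _ cs (cz.fun_mul cz),
      ← cfc_mul _ _ _ (cs.fun_mul (cz.fun_mul cz)) cs]
    refine cfc_congr fun y hy => ?_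
    have h := hxs y hy
    have := Real.mul_self_sqrt h.le
    calc √(t + y) * (y / (t + y) * (y / (t + y))) * √(t + y)
        = (√(t + y) * √(t + y)) * (y / (t + y) * (y / (t + y))) := by ring
      _ = y ^ 2 / (t + y) := by rw [this]; field_simp
  have hPqqP : ψ x * q * q * ψ x = cfc (fun y : ℝ => y ^ 2 / (t + y)) (ψ x) := by
    have ci : ContinuousOn (fun y : ℝ => y) (spectrum ℝ (ψ x)) := by fun_prop
    rw [hq]
    conv_lhs => enter [2]; rw [← cfc_id' ℝ (ψ x)]
    conv_lhs => enter [1, 1, 1]; rw [← cfc_id' ℝ (ψ x)]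
    rw [← cfc_mul _ _ _ ci cq, ← cfc_mul _ _ _ (ci.fun_mul cq) cq,
      ← cfc_mul _ _ _ ((ci.fun_mul cq).fun_mul cq) ci]
    refine cfc_congr fun y hy => ?_
    have h := hPs y hy
    have := Real.mul_self_sqrt h.le
    calc y * (√(t + y))⁻¹ * (√(t + y))⁻¹ * y = y ^ 2 / (√(t + y) * √(t + y)) := by
          rw [div_eq_mul_inv, mul_inv]; ring
      _ = y ^ 2 / (t + y) := by rw [this]
  -- `ψ (s * s) = t • ψ 1 + ψ x` is at most `t + ψ x`, the inverse of `q * q`.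
  have hsub : ψ.conj hsa hqa 1 ≤ 1 := by
    rw [PositiveLinearMap.conj_apply, hss, map_add, PositiveLinearMap.map_smul_of_tower]
    calc q * (t • ψ 1 + ψ x) * q ≤ q * (t • 1 + ψ x) * q := by
          refine hqa.conjugate_le_conjugate ?_
          gcongr
      _ = (q * u) * (u * q) := by rw [← huu]; simp only [mul_assoc]
      _ = 1 := by rw [huq, hqu, one_mul]
  have hK := (ψ.conj hsa hqa).mul_self_le_of_le_one hsub hz₀ hz₁
  simp only [PositiveLinearMap.conj_apply, hszs, hszzs] at hK
  have hK' := hua.conjugate_le_conjugate hK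
  have e₁ : u * (q * ψ x * q * (q * ψ x * q)) * u = ψ x * q * q * ψ x := by
    calc _ = (u * q) * (ψ x * q * q * ψ x) * (q * u) := by simp only [mul_assoc]
      _ = _ := by rw [huq, hqu, one_mul, mul_one]
  have e₂ : ∀ w : B, u * (q * w * q) * u = w := fun w => by
    calc _ = (u * q) * w * (q * u) := by simp only [mul_assoc]
      _ = _ := by rw [huq, hqu, one_mul, mul_one]
  rwa [e₁, e₂, hPqqP] at hK'

/-! ### Integral representation of the power -/

lemma cfc_rpowIntegrand₁₂_eq_smul {x : A} (hx : 0 ≤ x) (r : ℝ) {t : ℝ} (ht : 0 < t) :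
    cfc (Real.rpowIntegrand₁₂ r t) x
      = (t ^ (r - 1) * t⁻¹) • cfc (fun y : ℝ => y ^ 2 / (t + y)) x := by
  have hxs : ∀ y ∈ spectrum ℝ x, 0 < t + y := fun y hy =>
    add_pos_of_pos_of_nonneg ht (spectrum_nonneg_of_nonneg hx hy)
  have hcont : ContinuousOn (fun y : ℝ => y ^ 2 / (t + y)) (spectrum ℝ x) :=
    ContinuousOn.div (by fun_prop) (by fun_prop) fun y hy => (hxs y hy).ne'
  rw [← cfc_smul _ _ _ hcont]
  refine cfc_congr fun y hy => ?_
  have := hxs y hy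
  simp only [Real.rpowIntegrand₁₂, smul_eq_mul]
  rw [mul_assoc]
  congr 1
  field_simp
  ring

lemma PositiveLinearMap.cfc_rpowIntegrand₁₂_le (ψ : A →ₚ[ℂ] B) (hψ : ψ 1 ≤ 1) {x : A}
    (hx : 0 ≤ x) (r : ℝ) {t : ℝ} (ht : 0 < t) :
    cfc (Real.rpowIntegrand₁₂ r t) (ψ x) ≤ ψ (cfc (Real.rpowIntegrand₁₂ r t) x) := by
  rw [cfc_rpowIntegrand₁₂_eq_smul hx r ht, cfc_rpowIntegrand₁₂_eq_smul (map_nonneg ψ hx) r ht,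
    PositiveLinearMap.map_smul_of_tower]
  exact smul_le_smul_of_nonneg_left (ψ.cfc_sq_div_add_le hψ hx ht) (by positivity)

/-- A measure representing `x ↦ x ^ r` on the reals represents it on every C⋆-algebra. -/
lemma integrableOn_and_rpow_eq_integral_cfc_rpowIntegrand₁₂ {r : ℝ} (hr : r ∈ Ioo 1 2)
    {μ : Measure ℝ}
    (hμ : ∀ x ∈ Ici (0 : ℝ), IntegrableOn (fun t => Real.rpowIntegrand₁₂ r t x) (Ioi 0) μ
      ∧ x ^ r = ∫ t in Ioi 0, Real.rpowIntegrand₁₂ r t x ∂μ) {a : A} (ha : 0 ≤ a) :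
    IntegrableOn (fun t => cfc (Real.rpowIntegrand₁₂ r t) a) (Ioi 0) μ
      ∧ a ^ r = ∫ t in Ioi 0, cfc (Real.rpowIntegrand₁₂ r t) a ∂μ := by
  have hspec : ∀ y ∈ spectrum ℝ a, 0 ≤ y := fun y hy => spectrum_nonneg_of_nonneg ha hy
  have hf : ContinuousOn (Function.uncurry (Real.rpowIntegrand₁₂ r))
      (Ioi (0 : ℝ) ×ˢ spectrum ℝ a) :=
    Real.continuousOn_rpowIntegrand₁₂_uncurry hr.1 _ hspec
  have hnorm : (0 : ℝ) ≤ ‖a‖ * ‖(1 : A)‖ := by positivity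
  -- The integrand increases in its argument, so its value at a bound for the spectrum dominates.
  -- The spectral bound keeps the factor `‖1‖` since `‖1‖ = 1` is not assumed.
  have hbound : ∀ᵐ t ∂μ.restrict (Ioi 0), ∀ z ∈ spectrum ℝ a,
      ‖Real.rpowIntegrand₁₂ r t z‖ ≤ ‖Real.rpowIntegrand₁₂ r t (‖a‖ * ‖(1 : A)‖)‖ := by
    filter_upwards [ae_restrict_mem measurableSet_Ioi] with t ht z hz
    rw [Real.norm_of_nonneg (Real.rpowIntegrand₁₂_nonneg hr.1 (le_of_lt ht) (hspec z hz)),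
      Real.norm_of_nonneg (Real.rpowIntegrand₁₂_nonneg hr.1 (le_of_lt ht) hnorm)]
    refine Real.monotoneOn_rpowIntegrand₁₂ hr ht (hspec z hz) hnorm ?_
    exact (Real.le_norm_self z).trans (spectrum.norm_le_norm_mul_of_mem hz)
  have hfin : HasFiniteIntegral (fun t => ‖Real.rpowIntegrand₁₂ r t (‖a‖ * ‖(1 : A)‖)‖)
      (μ.restrict (Ioi 0)) := by
    rw [hasFiniteIntegral_norm_iff]
    exact (hμ _ hnorm).1.2
  refine ⟨integrableOn_cfc measurableSet_Ioi _ _ a hf hbound hfin ha.isSelfAdjoint, ?_⟩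
  rw [← cfc_setIntegral measurableSet_Ioi _ _ a hf hbound hfin ha.isSelfAdjoint,
    CFC.rpow_eq_cfc_real ha]
  exact cfc_congr fun y hy => (hμ y (hspec y hy)).2

/-- Jensen's inequality for `x ↦ x ^ r`, `1 < r ≤ 2`, and a subunital positive map. -/
theorem PositiveLinearMap.map_rpow_le (ψ : A →ₚ[ℂ] B) (hψ : ψ 1 ≤ 1) {r : ℝ} (hr₁ : 1 < r)
    (hr₂ : r ≤ 2) {x : A} (hx : 0 ≤ x) : ψ x ^ r ≤ ψ (x ^ r) := by
  have hP : 0 ≤ ψ x := map_nonneg ψ hx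
  rcases hr₂.lt_or_eq with hr | rfl
  -- The measure comes from the scalar representation, so the same `μ` serves `x` in `A` and `ψ x`
  -- in `B`.
  · obtain ⟨μ, hμ⟩ := Real.exists_measure_rpow_eq_integral_rpowIntegrand₁₂ (p := r) ⟨hr₁, hr⟩
    obtain ⟨hi, he⟩ := integrableOn_and_rpow_eq_integral_cfc_rpowIntegrand₁₂ ⟨hr₁, hr⟩ hμ hx
    obtain ⟨hi', he'⟩ := integrableOn_and_rpow_eq_integral_cfc_rpowIntegrand₁₂ ⟨hr₁, hr⟩ hμ hP
    -- Positive maps are automatically continuous, so `ψ` commutes with the integral.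
    let L : A →L[ℂ] B := ⟨ψ.toLinearMap, map_continuous ψ⟩
    have hL : ∀ y, L y = ψ y := fun _ => rfl
    rw [he, he', ← hL (∫ _ in _, _ ∂_), ← L.integral_comp_comm hi]
    refine integral_mono_ae hi' (L.integrable_comp hi) ?_
    filter_upwards [ae_restrict_mem measurableSet_Ioi] with t ht
    exact ψ.cfc_rpowIntegrand₁₂_le hψ hx r ht
  · have h2 : ((2 : ℕ) : ℝ) = 2 := by norm_num
    rw [← h2, CFC.rpow_natCast _ _ hx, CFC.rpow_natCast _ _ hP, pow_two, pow_two]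
    exact ψ.mul_self_le hψ hx

/-! ### Families of maps and weights -/

lemma CFC.smul_rpow {c : ℝ} (hc : 0 ≤ c) {r : ℝ} (hr : 0 ≤ r) {x : A} (hx : 0 ≤ x) :
    (c • x) ^ r = c ^ r • x ^ r := by
  have hspec : ∀ y ∈ spectrum ℝ x, 0 ≤ y := fun y hy => spectrum_nonneg_of_nonneg hx hy
  have hcont : ∀ s : Set ℝ, ContinuousOn (fun y : ℝ => y ^ r) s := fun s =>
    (Real.continuous_rpow_const hr).continuousOn
  rw [CFC.rpow_eq_cfc_real (smul_nonneg hc hx), CFC.rpow_eq_cfc_real hx,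
    ← cfc_smul _ _ _ (hcont _), ← cfc_comp_smul c _ x (hcont _) hx.isSelfAdjoint]
  exact cfc_congr fun y hy => Real.mul_rpow hc (hspec y hy)

lemma StarAlgHom.map_rpow (π : A →⋆ₐ[ℂ] B) {r : ℝ} (hr : 0 ≤ r) {x : A} (hx : 0 ≤ x) :
    π (x ^ r) = π x ^ r := by
  rw [CFC.rpow_eq_cfc_real hx, CFC.rpow_eq_cfc_real (map_nonneg π hx)]
  exact StarAlgHomClass.map_cfc (R := ℝ) (S := ℂ) π _ x
    (Real.continuous_rpow_const hr).continuousOn (map_continuous π)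
    hx.isSelfAdjoint (map_nonneg π hx).isSelfAdjoint

/-- Jensen's inequality for a subunital weighted sum of positive maps composed with star
homomorphisms on a common C⋆-algebra. -/
lemma sum_smul_positiveLinearMap_starAlgHom_rpow_le {C : Type*} [CStarAlgebra C] [PartialOrder C]
    [StarOrderedRing C] {ι : Type*} [Fintype ι] (π : ι → (C →⋆ₐ[ℂ] A)) (φ : ι → (A →ₚ[ℂ] B))
    {w : ι → ℝ} (hw : ∀ i, 0 ≤ w i) (hφ : ∑ i, w i • φ i 1 ≤ 1) {r : ℝ} (hr₁ : 1 < r)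
    (hr₂ : r ≤ 2) {x : C} (hx : 0 ≤ x) :
    (∑ i, w i • φ i (π i x)) ^ r ≤ ∑ i, w i • φ i (π i x ^ r) := by
  let L : C →ₗ[ℂ] B := ∑ i, (w i : ℂ) • (φ i).toLinearMap ∘ₗ (π i : C →ₐ[ℂ] A).toLinearMap
  have hL : ∀ y, L y = ∑ i, w i • φ i (π i y) := fun y => by
    simp only [L, LinearMap.sum_apply, LinearMap.smul_apply, Complex.coe_smul]
    rfl
  let ψ : C →ₚ[ℂ] B := .mk₀ L fun y hy => by
    rw [hL]
    exact Finset.sum_nonneg fun i _ =>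
      smul_nonneg (hw i) (map_nonneg (φ i) (map_nonneg (π i) hy))
  have hψ : ∀ y, ψ y = ∑ i, w i • φ i (π i y) := hL
  have key := ψ.map_rpow_le (by simpa [hψ] using hφ) hr₁ hr₂ hx
  simpa only [hψ, StarAlgHom.map_rpow (π _) (zero_le_one.trans hr₁.le) hx] using key

/-- Jensen's inequality for a subunital weighted sum of positive maps. -/
theorem sum_smul_positiveLinearMap_rpow_le {ι : Type*} [Fintype ι] (φ : ι → (A →ₚ[ℂ] B))
    {w : ι → ℝ} (hw : ∀ i, 0 ≤ w i) (hφ : ∑ i, w i • φ i 1 ≤ 1) {r : ℝ} (hr₁ : 1 < r)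
    (hr₂ : r ≤ 2) {x : ι → A} (hx : ∀ i, 0 ≤ x i) :
    (∑ i, w i • φ i (x i)) ^ r ≤ ∑ i, w i • φ i (x i ^ r) :=
  -- The tuple `x` is one positive element of the product algebra, and the coordinate projections
  -- are star homomorphisms, hence respect powers.
  sum_smul_positiveLinearMap_starAlgHom_rpow_le (C := ι → A)
    (fun i => Pi.evalStarAlgHom ℂ (fun _ : ι => A) i) φ hw hφ hr₁ hr₂ hx

/-- Weighted power inequality for a finite family of positive maps between C⋆-algebras. -/
theorem sum_positiveLinearMap_rpow_le {ι : Type*} [Fintype ι] {r : ℝ} (hr₁ : 1 < r) (hr₂ : r ≤ 2)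
    {a : ι → ℝ} (ha : ∀ i, 0 < a i) (φ : ι → (A →ₚ[ℂ] B))
    (hφ : ∑ i, (a i ^ (1 / (1 - r))) • φ i 1 ≤ (∑ i, a i ^ (1 / (1 - r))) • (1 : B))
    {x : ι → A} (hx : ∀ i, 0 ≤ x i) :
    (∑ i, φ i (x i)) ^ r
      ≤ (∑ i, a i ^ (1 / (1 - r))) ^ (r - 1) • ∑ i, a i • φ i (x i ^ r) := by
  have hr₀ : 0 < r := by linarith
  rcases isEmpty_or_nonempty ι with hι | hι
  · simpa using (CFC.zero_rpow (A := B) hr₀.ne').le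
  set c : ι → ℝ := fun i => a i ^ (1 / (1 - r)) with hc
  have hc₀ : ∀ i, 0 < c i := fun i => Real.rpow_pos_of_pos (ha i) _
  -- The choice of exponent: `c ^ (1 - r) = a`.
  have hca : ∀ i, c i * ((c i)⁻¹) ^ r = a i := fun i => by
    have h1 : (1 : ℝ) - r ≠ 0 := by linarith
    rw [Real.inv_rpow (hc₀ i).le, ← Real.rpow_neg (hc₀ i).le]
    nth_rw 1 [← Real.rpow_one (c i)]
    rw [← Real.rpow_add (hc₀ i), hc, ← Real.rpow_mul (ha i).le, ← sub_eq_add_neg,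
      one_div_mul_cancel h1, Real.rpow_one]
  change ∑ i, c i • φ i 1 ≤ (∑ i, c i) • 1 at hφ
  change _ ≤ (∑ i, c i) ^ (r - 1) • _
  set C : ℝ := ∑ i, c i with hC
  have hC₀ : 0 < C := Finset.sum_pos (fun i _ => hc₀ i) Finset.univ_nonempty
  have hCi : 0 ≤ C⁻¹ := inv_nonneg.mpr hC₀.le
  have hφ' : ∑ i, (C⁻¹ * c i) • φ i 1 ≤ 1 := by
    simp only [mul_smul, ← Finset.smul_sum]
    calc _ ≤ C⁻¹ • (C • (1 : B)) := smul_le_smul_of_nonneg_left hφ hCi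
      _ = 1 := inv_smul_smul₀ hC₀.ne' _
  have key := sum_smul_positiveLinearMap_rpow_le φ (fun i => mul_nonneg hCi (hc₀ i).le) hφ' hr₁ hr₂
    (x := fun i => (c i)⁻¹ • x i) fun i => smul_nonneg (inv_nonneg.mpr (hc₀ i).le) (hx i)
  have e₁ : ∑ i, (C⁻¹ * c i) • φ i ((c i)⁻¹ • x i) = C⁻¹ • ∑ i, φ i (x i) := by
    rw [Finset.smul_sum]
    refine Finset.sum_congr rfl fun i _ => ?_
    rw [PositiveLinearMap.map_smul_of_tower, mul_smul, smul_inv_smul₀ (hc₀ i).ne']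
  have e₂ : ∑ i, (C⁻¹ * c i) • φ i (((c i)⁻¹ • x i) ^ r) = C⁻¹ • ∑ i, a i • φ i (x i ^ r) := by
    rw [Finset.smul_sum]
    refine Finset.sum_congr rfl fun i _ => ?_
    rw [CFC.smul_rpow (inv_nonneg.mpr (hc₀ i).le) hr₀.le (hx i),
      PositiveLinearMap.map_smul_of_tower, mul_smul, smul_smul (c i), hca]
  have hS₀ : 0 ≤ ∑ i, φ i (x i) := Finset.sum_nonneg fun i _ => map_nonneg (φ i) (hx i)
  rw [e₁, e₂, CFC.smul_rpow hCi hr₀.le hS₀] at key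
  -- Multiplying by `C ^ r` cancels `C⁻¹ ^ r` on the left and leaves `C ^ (r - 1)` on the right.
  have key' := smul_le_smul_of_nonneg_left key (Real.rpow_nonneg hC₀.le r)
  rwa [smul_smul, smul_smul, ← Real.mul_rpow hC₀.le hCi,
    mul_inv_cancel₀ hC₀.ne', Real.one_rpow, one_smul, ← div_eq_mul_inv,
    ← Real.rpow_sub_one hC₀.ne'] at key'

end Jensen

theorem mainTheorem6
    {H K : Type*}
    [NormedAddCommGroup H] [InnerProductSpace ℂ H] [CompleteSpace H]
    [NormedAddCommGroup K] [InnerProductSpace ℂ K] [CompleteSpace K]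
    (n : ℕ) (r : ℝ) (hr₁ : 1 < r) (hr₂ : r ≤ 2)
    (a : Fin n → ℝ) (ha : ∀ i, 0 < a i)
    (φ : Fin n → ((H →L[ℂ] H) →ₚ[ℂ] (K →L[ℂ] K)))
    (hφ : ∑ i, (a i ^ (1 / (1 - r))) • φ i (1 : H →L[ℂ] H)
      ≤ (∑ i, a i ^ (1 / (1 - r))) • (1 : K →L[ℂ] K))
    (A : Fin n → (H →L[ℂ] H)) (hA : ∀ i, 0 ≤ A i) :
    (∑ i, φ i (A i)) ^ r
      ≤ (∑ i, a i ^ (1 / (1 - r))) ^ (r - 1) • ∑ i, a i • φ i (A i ^ r) := by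
  exact sum_positiveLinearMap_rpow_le hr₁ hr₂ ha φ hφ hA
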